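/- Let $H$ be a complex Hilbert space with inner product $(\cdot,\cdot)$ (linear in the first argument) and norm $\|\cdot\|$, and let $N$ be a complex normed space; suppose that $H$ and $N$ are algebraically embedded in a common complex linear space. Let $L$ be a normal (densely defined, closed, possibly unbounded) linear operator in $H$, and let $E=E(\delta)$, $\delta\in\mathcal B(\mathbb C)$, be the resolution of the identity (spectral measure on the Borel sets of $\mathbb C$) generated by $L$, so that $L=\int_{\mathbb C}z\,dE(z)$. Put $\widetilde B_\lambda=\{z\in\mathbb C:|z|\le\lambda\}$. A bounded operator $T$ on $H$ is said to commute with $L$ if $TL\subseteq LT$, i.e. if $Tf\in\mathrm{Dom}\,L$ and $LTf=TLf$ for every $f\in\mathrm{Dom}\,L$. The spectral expansion $f=\int_{\mathbb C}dE\,f$ is said to converge unconditionally in $N$ at $f\in H$ if $E(\delta)f\in N$ for every $\delta\in\mathcal B(\mathbb C)$ and if for every $\varepsilon>0$ there is a bounded $\gamma\in\mathcal B(\mathbb C)$ such that $\|f-E(\delta)f\|_N<\varepsilon$ whenever $\gamma\subseteq\delta\in\mathcal B(\mathbb C)$. **(A)** Let $R,S$ be bounded linear operators on $H$ that commute with $L$,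 and let $R$ be a bounded operator from $H$ to $N$. Then the expansion $f=\int_{\mathbb C}dE\,f$ converges unconditionally in $N$ at every $f\in RS(H)$. Moreover, for every $g\in H$ there is a function $r_g:\mathcal B(\mathbb C)\to[0,1]$, not depending on $R$ and $S$, that is decreasing with respect to inclusion (i.e. $\delta\subseteq\delta'$ implies $r_g(\delta')\le r_g(\delta)$) and satisfies $r_g(\widetilde B_\lambda)\to0$ as $\lambda\to\infty$, such that for all such $R,S$, for $f=RSg$ and every $\delta\in\mathcal B(\mathbb C)$, $$\|f-E(\delta)f\|_N\le\|R\|_{H\to N}\,\|g\|\,\|S(I-E(\delta))\|_{H\to H}\,r_g(\delta).$$ **(B)** Suppose that $H$ has an orthonormal basis $(e_j)_{j=1}^\infty$ formed by eigenvectors of $L$, and let $P_k$ be the orthoprojector of $H$ onto the linear span of $e_1,\dots,e_k$. Let $\omega,\eta:\mathrm{Spec}\,L\to\mathbb C\setminus\{0\}$ be bounded Borel measurable functions, put $R:=\omega(L)$ and $S:=\eta(L)$, and let $R$ be a bounded operator from $H$ to $N$. Then $RS$ is injective, and at every $f\in RS(H)$ the series $\sum_{j=1}^\infty(f,e_j)e_j$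 converges to $f$ in $N$ under each permutation of its terms. Moreover, for every $g\in H$ there is a decreasing sequence $(r_{g,k})_k$ in $[0,1]$ that tends to zero as $k\to\infty$ and does not depend on $\omega$ and $\eta$ (i.e. on $R$ and $S$), such that for all such $R,S$, for $f=RSg$ (i.e. $g=(RS)^{-1}f$) and every integer $k\ge1$, $$\Bigl\|f-\sum_{j=1}^k(f,e_j)e_j\Bigr\|_N\le\|R\|_{H\to N}\,\|g\|\,\|S(I-P_k)\|_{H\to H}\,r_{g,k}.$$ -/

import Mathlib

open MeasureTheory Filter Topology
open scoped ENNReal InnerProductSpace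

noncomputable section

/-! ### Unbounded operators -/

/-- A (possibly unbounded) operator `L` in a Hilbert space is normal if it is densely defined,
closed, and `L† L = L L†` as partially defined operators (equality of graphs, hence in particular
of domains). -/
def LinearPMap.IsNormalOperator {H : Type*} [NormedAddCommGroup H] [InnerProductSpace ℂ H]
    [CompleteSpace H] (L : H →ₗ.[ℂ] H) : Prop :=
  Dense (L.domain : Set H) ∧ L.IsClosed ∧
    ∀ x z : H, (∃ y : H, (x, y) ∈ L.graph ∧ (y, z) ∈ L.adjoint.graph) ↔
      (∃ y : H, (x, y) ∈ L.adjoint.graph ∧ (y, z) ∈ L.graph)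

/-- The bounded operator `T` commutes with the operator `L`, i.e. `T L ⊆ L T`: if `x ∈ Dom L`, then
`T x ∈ Dom L` and `L (T x) = T (L x)`. -/
def LinearPMap.CommutesWith {H : Type*} [NormedAddCommGroup H] [InnerProductSpace ℂ H]
    (L : H →ₗ.[ℂ] H) (T : H →L[ℂ] H) : Prop :=
  ∀ x y : H, (x, y) ∈ L.graph → (T x, T y) ∈ L.graph

/-- The resolvent set: those `z` for which `L - z : Dom L → H` has a bounded everywhere defined
two-sided inverse. -/
def LinearPMap.resolventSet {H : Type*} [NormedAddCommGroup H] [InnerProductSpace ℂ H]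
    (L : H →ₗ.[ℂ] H) : Set ℂ :=
  {z | ∃ B : H →L[ℂ] H, (∀ x : L.domain, B (L x - z • (x : H)) = x) ∧
    ∀ y : H, ∃ x : L.domain, (x : H) = B y ∧ L x - z • (x : H) = y}

/-- The spectrum `Spec L` of a (possibly unbounded) operator. -/
def LinearPMap.spec {H : Type*} [NormedAddCommGroup H] [InnerProductSpace ℂ H]
    (L : H →ₗ.[ℂ] H) : Set ℂ :=
  L.resolventSetᶜ

/-! ### Spectral measures -/

/-- A resolution of the identity on the Borel sets of `ℂ`: orthogonal projections `E δ`, with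
`E ℂ = I`, countably additive in the strong operator topology. Only the values on Borel sets
matter. -/
structure SpectralMeasure (H : Type*) [NormedAddCommGroup H] [InnerProductSpace ℂ H]
    [CompleteSpace H] where
  toFun : Set ℂ → H →L[ℂ] H
  isStarProjection' : ∀ δ, MeasurableSet δ → IsStarProjection (toFun δ)
  map_univ' : toFun Set.univ = 1
  hasSum_iUnion' : ∀ δ : ℕ → Set ℂ, (∀ n, MeasurableSet (δ n)) →
    Pairwise (Function.onFun Disjoint δ) → ∀ f : H,
      HasSum (fun n => toFun (δ n) f) (toFun (⋃ n, δ n) f)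

namespace SpectralMeasure

variable {H : Type*} [NormedAddCommGroup H] [InnerProductSpace ℂ H] [CompleteSpace H]

instance : CoeFun (SpectralMeasure H) (fun _ => Set ℂ → H →L[ℂ] H) := ⟨SpectralMeasure.toFun⟩

lemma map_empty_apply (E : SpectralMeasure H) (f : H) : E ∅ f = 0 := by
  have h := (E.hasSum_iUnion' (fun _ => ∅) (fun _ => MeasurableSet.empty)
    (fun _ _ _ => disjoint_bot_left) f).summable
  exact tendsto_nhds_unique tendsto_const_nhds h.tendsto_atTop_zero

lemma inner_apply_self (E : SpectralMeasure H) {δ : Set ℂ} (hδ : MeasurableSet δ) (f : H) :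
    ⟪f, E δ f⟫_ℂ = ((‖E δ f‖ ^ 2 : ℝ) : ℂ) := by
  have hp := E.isStarProjection' δ hδ
  have h1 : E δ (E δ f) = E δ f := congrArg (fun T : H →L[ℂ] H => T f) hp.isIdempotentElem.eq
  have h2 : ContinuousLinearMap.adjoint (E δ) = E δ := hp.isSelfAdjoint.star_eq
  calc ⟪f, E δ f⟫_ℂ = ⟪f, E δ (E δ f)⟫_ℂ := by rw [h1]
    _ = ⟪ContinuousLinearMap.adjoint (E δ) f, E δ f⟫_ℂ := by
        rw [ContinuousLinearMap.adjoint_inner_left]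
    _ = ⟪E δ f, E δ f⟫_ℂ := by rw [h2]
    _ = _ := by rw [inner_self_eq_norm_sq_to_K]; push_cast; rfl

/-- The finite positive measure `μ_f(δ) = (E(δ) f, f) = ‖E(δ) f‖²`. -/
def scalarMeasure (E : SpectralMeasure H) (f : H) : Measure ℂ :=
  Measure.ofMeasurable (fun δ _ => ENNReal.ofReal (‖E δ f‖ ^ 2))
    (by simp [map_empty_apply])
    (by
      intro δ hδ hd
      have h := E.hasSum_iUnion' δ hδ hd f
      have h2 : HasSum (fun n => ⟪f, E (δ n) f⟫_ℂ) ⟪f, E (⋃ n, δ n) f⟫_ℂ :=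
        h.mapL (innerSL ℂ f)
      rw [E.inner_apply_self (MeasurableSet.iUnion hδ)] at h2
      simp_rw [fun n => E.inner_apply_self (hδ n) f] at h2
      rw [Complex.hasSum_ofReal] at h2
      rw [← h2.tsum_eq]
      exact ENNReal.ofReal_tsum_of_nonneg (fun n => by positivity) h2.summable)

lemma scalarMeasure_apply (E : SpectralMeasure H) (f : H) {δ : Set ℂ} (hδ : MeasurableSet δ) :
    E.scalarMeasure f δ = ENNReal.ofReal (‖E δ f‖ ^ 2) :=
  Measure.ofMeasurable_apply δ hδ

/-- `T = ∫ φ dE`: the domain of `T` consists of all `f` with `∫ |φ|² d(E f, f) < ∞`, and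
`(T f, f) = ∫ φ d(E f, f)` on this domain. (By polarization, this determines `T`.) -/
def IsIntegral (E : SpectralMeasure H) (φ : ℂ → ℂ) (T : H →ₗ.[ℂ] H) : Prop :=
  (∀ f : H, f ∈ T.domain ↔ ∫⁻ z, ‖φ z‖ₑ ^ 2 ∂(E.scalarMeasure f) < ∞) ∧
    ∀ f : T.domain, ⟪(f : H), T f⟫_ℂ = ∫ z, φ z ∂(E.scalarMeasure f)

/-- `E` is the resolution of the identity generated by `L`, i.e. `L = ∫ z dE(z)`. -/
def IsGeneratedBy (E : SpectralMeasure H) (L : H →ₗ.[ℂ] H) : Prop :=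
  E.IsIntegral (fun z => z) L

/-- `T = ω(L) = ∫_{Spec L} ω dE`, where `E` is the resolution of the identity generated by `L`
and `T` is bounded on the whole of `H`. -/
def IsFunctionOf (E : SpectralMeasure H) (L : H →ₗ.[ℂ] H) (ω : L.spec → ℂ) (T : H →L[ℂ] H) :
    Prop :=
  E.IsIntegral (Function.extend Subtype.val ω 0) ((T : H →ₗ[ℂ] H).toPMap ⊤)

end SpectralMeasure

/-! ### Two spaces embedded in a common linear space -/

section TwoNorms

variable {H N V : Type*} [NormedAddCommGroup H] [InnerProductSpace ℂ H] [CompleteSpace H]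
  [NormedAddCommGroup N] [NormedSpace ℂ N] [AddCommGroup V] [Module ℂ V]

/-- `RN` is the operator `R` regarded as a bounded operator from `H` to `N`, where `H` and `N` are
embedded in `V` by `ιH` and `ιN`. -/
def IsBoundedInto (ιH : H →ₗ[ℂ] V) (ιN : N →ₗ[ℂ] V) (R : H →L[ℂ] H) (RN : H →L[ℂ] N) : Prop :=
  ∀ h : H, ιN (RN h) = ιH (R h)

/-- The vector `h ∈ H` belongs to `N`, and `p` holds for it as an element of `N`. -/
def InSpaceWith (ιH : H →ₗ[ℂ] V) (ιN : N →ₗ[ℂ] V) (h : H) (p : N → Prop) : Prop :=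
  ∃ u : N, ιN u = ιH h ∧ p u

/-- The spectral expansion `f = ∫ dE f` converges unconditionally in `N` at `f`. -/
def ConvergesUncond (ιH : H →ₗ[ℂ] V) (ιN : N →ₗ[ℂ] V) (E : SpectralMeasure H) (f : H) : Prop :=
  (∀ δ : Set ℂ, MeasurableSet δ → InSpaceWith ιH ιN (E δ f) fun _ => True) ∧
    ∀ ε : ℝ, 0 < ε → ∃ γ : Set ℂ, MeasurableSet γ ∧ Bornology.IsBounded γ ∧
      ∀ δ : Set ℂ, MeasurableSet δ → γ ⊆ δ →
        InSpaceWith ιH ιN (f - E δ f) fun u => ‖u‖ < ε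

/-- The series `∑ x j` of vectors of `H` converges to `f` in the space `N` under each permutation
of its terms (all `x j` and `f` belonging to `N`). -/
def SeriesConvergesUncond (ιH : H →ₗ[ℂ] V) (ιN : N →ₗ[ℂ] V) (x : ℕ → H) (f : H) : Prop :=
  ∃ u : ℕ → N, (∀ j, ιN (u j) = ιH (x j)) ∧
    InSpaceWith ιH ιN f fun v => ∀ σ : Equiv.Perm ℕ,
      Tendsto (fun n => ∑ j ∈ Finset.range n, u (σ j)) atTop (𝓝 v)

end TwoNorms

/-- The orthoprojector onto the linear span of the first `k` vectors of an orthonormal basis. -/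
def basisProj {H : Type*} [NormedAddCommGroup H] [InnerProductSpace ℂ H] [CompleteSpace H]
    (e : HilbertBasis ℕ ℂ H) (k : ℕ) : H →L[ℂ] H :=
  haveI : FiniteDimensional ℂ (Submodule.span ℂ (Set.range fun j : Fin k => e j)) :=
    FiniteDimensional.span_of_finite ℂ (Set.finite_range _)
  (Submodule.span ℂ (Set.range fun j : Fin k => e j)).starProjection

end

/-! Both estimates are one computation. If an idempotent `P` commutes with `R` and `S`, and f = RSg,
then f - Pf = R · S(I - P) · (g - Pg), so the N-norm is at most ‖R‖ ‖S(I - P)‖ ‖g - Pg‖, and r_g =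
‖g - Pg‖ / ‖g‖ depends on neither R nor S. Convergence in N is convergence of the expansion of g in
H, transported by the bounded map RS : H → N.

In (A), P = E(δ), and commutation is Fuglede's theorem (`IsGeneratedBy.commute_apply`). On the range
of E of a closed disc of radius r the operator L is within 2r of the centre, so for discs with
centres b, c further than 4r apart E(B_b) T E(B_c) is too small relative to itself and vanishes.
Covering arguments and adjoints extend this to E(U) T E(Uᶜ) = 0 = E(Uᶜ) T E(U) for open U, and a π-λ
argument gives all Borel sets.

In (B), P_k need not be a spectral projection, since eigenvalues may repeat. Instead each e_j lies
in the range of E({λ_j}), which makes ω(L) and η(L) diagonal in the basis with nonzero entries;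
hence they commute with P_k and RS is injective. -/

namespace SpectralMeasure

/-! ### Algebra of spectral projections and their scalar measures -/

section Basic

variable {H : Type*} [NormedAddCommGroup H] [InnerProductSpace ℂ H] [CompleteSpace H]
  (E : SpectralMeasure H)

lemma apply_apply_self {δ : Set ℂ} (hδ : MeasurableSet δ) (f : H) : E δ (E δ f) = E δ f :=
  congrArg (fun T : H →L[ℂ] H => T f) (E.isStarProjection' δ hδ).isIdempotentElem.eq

lemma star_apply {δ : Set ℂ} (hδ : MeasurableSet δ) : star (E δ) = E δ :=
  (E.isStarProjection' δ hδ).isSelfAdjoint.star_eq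

lemma inner_apply_left {δ : Set ℂ} (hδ : MeasurableSet δ) (f g : H) :
    ⟪E δ f, g⟫_ℂ = ⟪f, E δ g⟫_ℂ := by
  conv_lhs => rw [← E.star_apply hδ]
  exact ContinuousLinearMap.adjoint_inner_left (E δ) g f

lemma apply_union {δ δ' : Set ℂ} (hδ : MeasurableSet δ) (hδ' : MeasurableSet δ')
    (h : Disjoint δ δ') (f : H) : E (δ ∪ δ') f = E δ f + E δ' f := by
  have key := E.hasSum_iUnion' (fun n => if n = 0 then δ else if n = 1 then δ' else ∅)
    (fun n => by split_ifs <;> simp [hδ, hδ'])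
    (fun i j hij => by
      simp only [Function.onFun]
      split_ifs <;> simp_all [disjoint_comm]) f
  have hU : (⋃ n : ℕ, (if n = 0 then δ else if n = 1 then δ' else ∅)) = δ ∪ δ' := by
    ext z
    simp only [Set.mem_iUnion, Set.mem_union]
    constructor
    · rintro ⟨i, hi⟩
      split_ifs at hi <;> simp_all
    · rintro (hz | hz)
      · exact ⟨0, by simpa using hz⟩
      · exact ⟨1, by simpa using hz⟩
  rw [hU] at key
  refine key.unique ?_
  have h2 := hasSum_sum_of_ne_finset_zero (L := .unconditional ℕ) (s := Finset.range 2)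
    (f := fun n : ℕ => E (if n = 0 then δ else if n = 1 then δ' else ∅) f) (by
      intro b hb
      have h0 : b ≠ 0 := by rintro rfl; simp at hb
      have h1 : b ≠ 1 := by rintro rfl; simp at hb
      simp [h0, h1, E.map_empty_apply])
  simpa [Finset.sum_range_succ] using h2

lemma apply_compl {δ : Set ℂ} (hδ : MeasurableSet δ) (f : H) : E δᶜ f = f - E δ f := by
  have h := E.apply_union hδ hδ.compl disjoint_compl_right f
  rw [Set.union_compl_self, E.map_univ'] at h
  rw [eq_sub_iff_add_eq, add_comm]
  exact h.symm

/-- With P = E(δ), Q = E(δ'), idempotence of P + Q = E(δ ∪ δ') forces PQ + QP = 0. Multiplying by P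
on the left and on the right gives PQ = -PQP = QP, so 2PQ = 0. -/
lemma apply_disjoint {δ δ' : Set ℂ} (hδ : MeasurableSet δ) (hδ' : MeasurableSet δ')
    (h : Disjoint δ δ') (f : H) : E δ (E δ' f) = 0 := by
  have idem (x : H) : E δ (E δ' x) + E δ' (E δ x) = 0 := by
    have h1 := E.apply_apply_self (hδ.union hδ') x
    simp only [E.apply_union hδ hδ' h, map_add, E.apply_apply_self hδ,
      E.apply_apply_self hδ'] at h1
    have h2 : E δ (E δ' x) + E δ' (E δ x) =
        (E δ x + E δ (E δ' x) + (E δ' (E δ x) + E δ' x)) - (E δ x + E δ' x) := by abel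
    rw [h2, sub_eq_zero, ← h1]
  have h1 := idem f
  have h2 := congrArg (E δ) h1
  simp only [map_add, E.apply_apply_self hδ, map_zero] at h2
  have h3 := idem (E δ f)
  rw [E.apply_apply_self hδ] at h3
  have h4 : E δ (E δ' f) = E δ' (E δ f) := by
    rw [eq_neg_of_add_eq_zero_left h2, eq_neg_of_add_eq_zero_left h3, neg_neg]
  rw [← h4, ← two_smul ℂ] at h1
  simpa using h1

lemma apply_inter {δ δ' : Set ℂ} (hδ : MeasurableSet δ) (hδ' : MeasurableSet δ') (f : H) :
    E δ (E δ' f) = E (δ ∩ δ') f := by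
  have h1 := E.apply_union (hδ'.inter hδ) (hδ'.diff hδ) Set.disjoint_sdiff_inter.symm f
  rw [Set.inter_union_sdiff] at h1
  have h2 := E.apply_union (hδ.inter hδ') (hδ.diff hδ') Set.disjoint_sdiff_inter.symm
    (E (δ' ∩ δ) f)
  rw [Set.inter_union_sdiff, Set.inter_comm δ' δ, E.apply_apply_self (hδ.inter hδ'),
    E.apply_disjoint (hδ.diff hδ') (hδ.inter hδ') Set.disjoint_sdiff_inter, add_zero] at h2
  rw [h1, map_add, E.apply_disjoint hδ (hδ'.diff hδ) Set.disjoint_sdiff_right, add_zero,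
    Set.inter_comm δ' δ, h2]

lemma apply_comm {δ δ' : Set ℂ} (hδ : MeasurableSet δ) (hδ' : MeasurableSet δ') (f : H) :
    E δ (E δ' f) = E δ' (E δ f) := by
  rw [E.apply_inter hδ hδ', E.apply_inter hδ' hδ, Set.inter_comm]

lemma scalarMeasure_univ (f : H) : E.scalarMeasure f Set.univ = ENNReal.ofReal (‖f‖ ^ 2) := by
  rw [E.scalarMeasure_apply f MeasurableSet.univ, E.map_univ']
  rfl

instance (f : H) : IsFiniteMeasure (E.scalarMeasure f) :=
  ⟨by rw [E.scalarMeasure_univ]; exact ENNReal.ofReal_lt_top⟩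

lemma scalarMeasure_real_univ (f : H) : (E.scalarMeasure f).real Set.univ = ‖f‖ ^ 2 := by
  rw [Measure.real, E.scalarMeasure_univ, ENNReal.toReal_ofReal (by positivity)]

lemma norm_sq_apply {δ : Set ℂ} (hδ : MeasurableSet δ) (f : H) :
    ‖E δ f‖ ^ 2 = (E.scalarMeasure f).real δ := by
  rw [Measure.real, E.scalarMeasure_apply f hδ, ENNReal.toReal_ofReal (by positivity)]

lemma norm_apply_mono {δ δ' : Set ℂ} (hδ : MeasurableSet δ) (hδ' : MeasurableSet δ')
    (h : δ ⊆ δ') (f : H) : ‖E δ f‖ ≤ ‖E δ' f‖ := by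
  have : ‖E δ f‖ ^ 2 ≤ ‖E δ' f‖ ^ 2 := by
    rw [E.norm_sq_apply hδ, E.norm_sq_apply hδ']
    exact measureReal_mono h
  exact le_of_sq_le_sq this (norm_nonneg _)

lemma norm_apply_le {δ : Set ℂ} (hδ : MeasurableSet δ) (f : H) : ‖E δ f‖ ≤ ‖f‖ := by
  have := E.norm_apply_mono hδ MeasurableSet.univ (Set.subset_univ _) f
  rwa [E.map_univ'] at this

lemma scalarMeasure_eq_zero_iff {δ : Set ℂ} (hδ : MeasurableSet δ) (f : H) :
    E.scalarMeasure f δ = 0 ↔ E δ f = 0 := by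
  rw [E.scalarMeasure_apply f hδ, ENNReal.ofReal_eq_zero]
  constructor
  · intro h
    have : ‖E δ f‖ = 0 := by nlinarith [norm_nonneg (E δ f)]
    simpa using this
  · intro h; simp [h]

lemma scalarMeasure_apply_eq_restrict {δ : Set ℂ} (hδ : MeasurableSet δ) (f : H) :
    E.scalarMeasure (E δ f) = (E.scalarMeasure f).restrict δ := by
  ext s hs
  rw [Measure.restrict_apply hs, E.scalarMeasure_apply _ hs, E.scalarMeasure_apply _ (hs.inter hδ),
    E.apply_inter hs hδ]

lemma apply_eq_self_iff_compl {δ : Set ℂ} (hδ : MeasurableSet δ) (f : H) :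
    E δ f = f ↔ E δᶜ f = 0 := by
  rw [E.apply_compl hδ, sub_eq_zero, eq_comm]

lemma ae_mem {δ : Set ℂ} (hδ : MeasurableSet δ) {f : H} (hf : E δ f = f) :
    ∀ᵐ z ∂E.scalarMeasure f, z ∈ δ := by
  rw [ae_iff]
  exact (E.scalarMeasure_eq_zero_iff hδ.compl f).2 ((E.apply_eq_self_iff_compl hδ f).1 hf)

/-- Each E(s) commutes with E(δ), so E(s)f and E(s)g remain orthogonal and Pythagoras applies set by
set. -/
lemma scalarMeasure_add {δ : Set ℂ} (hδ : MeasurableSet δ) {f g : H} (hf : E δ f = f)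
    (hg : E δ g = 0) {c : ℂ} (hc : ‖c‖ = 1) :
    E.scalarMeasure (f + c • g) = E.scalarMeasure f + E.scalarMeasure g := by
  ext s hs
  rw [Measure.add_apply, E.scalarMeasure_apply _ hs, E.scalarMeasure_apply _ hs,
    E.scalarMeasure_apply _ hs, ← ENNReal.ofReal_add (by positivity) (by positivity), map_add,
    map_smul, sq, sq, sq, norm_add_sq_eq_norm_sq_add_norm_sq_of_inner_eq_zero (𝕜 := ℂ), norm_smul, hc,
    one_mul]
  rw [inner_smul_right, ← hf, E.apply_comm hs hδ, E.inner_apply_left hδ, E.apply_comm hδ hs, hg]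
  simp

lemma tendsto_norm_apply_of_antitone {s : ℕ → Set ℂ} (hs : ∀ n, MeasurableSet (s n))
    (hanti : Antitone s) (hempty : ⋂ n, s n = ∅) (f : H) :
    Tendsto (fun n => ‖E (s n) f‖) atTop (𝓝 0) := by
  have h := tendsto_measure_iInter_atTop (μ := E.scalarMeasure f)
    (fun n => (hs n).nullMeasurableSet) hanti ⟨0, measure_ne_top _ _⟩
  rw [hempty, measure_empty] at h
  have h2 := (ENNReal.tendsto_toReal (by simp)).comp h
  have h3 : Tendsto (fun n => ‖E (s n) f‖ ^ 2) atTop (𝓝 0) := by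
    refine h2.congr fun n => ?_
    simp only [Function.comp, E.norm_sq_apply (hs n)]
    rfl
  have h4 := h3.sqrt
  simpa [Real.sqrt_sq] using h4

lemma tendsto_norm_sub_closedBall (f : H) :
    Tendsto (fun t : ℝ => ‖f - E (Metric.closedBall 0 t) f‖) atTop (𝓝 0) := by
  have hm (t : ℝ) : MeasurableSet (Metric.closedBall (0 : ℂ) t) :=
    Metric.isClosed_closedBall.measurableSet
  simp_rw [fun t => (E.apply_compl (hm t) f).symm]
  have hanti {s t : ℝ} (h : s ≤ t) :
      (Metric.closedBall (0 : ℂ) t)ᶜ ⊆ (Metric.closedBall (0 : ℂ) s)ᶜ :=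
    Set.compl_subset_compl.2 (Metric.closedBall_subset_closedBall h)
  have hn := E.tendsto_norm_apply_of_antitone
    (s := fun n : ℕ => (Metric.closedBall (0 : ℂ) n)ᶜ) (fun n => (hm n).compl)
    (fun m n h => hanti (by exact_mod_cast h)) (by
      ext z
      obtain ⟨n, hn⟩ := exists_nat_ge ‖z‖
      simp only [Set.mem_iInter, Set.mem_compl_iff, Metric.mem_closedBall, dist_zero_right,
        Set.mem_empty_iff_false, iff_false, not_forall, not_not]
      exact ⟨n, hn⟩) f
  rw [Metric.tendsto_atTop] at hn ⊢
  intro ε hε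
  obtain ⟨n, hn⟩ := hn ε hε
  refine ⟨n, fun t ht => ?_⟩
  have h1 := hn n le_rfl
  simp only [dist_zero_right, norm_norm] at h1 ⊢
  exact (E.norm_apply_mono (hm t).compl (hm n).compl (hanti ht) f).trans_lt h1

end Basic

end SpectralMeasure

namespace SpectralMeasure

/-! ### From the quadratic form of L to commutation with E -/

section Generated

variable {H : Type*} [NormedAddCommGroup H] [InnerProductSpace ℂ H] [CompleteSpace H]
  {E : SpectralMeasure H}

/-- The integral representation only prescribes the quadratic form. Its values at f + cg, |c| = 1,
are additive because the scalar measures are; comparing c = 1 with c = i kills both cross terms. -/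
lemma IsIntegral.inner_eq_zero {φ : ℂ → ℂ} {T : H →ₗ.[ℂ] H} (hT : E.IsIntegral φ T)
    {δ : Set ℂ} (hδ : MeasurableSet δ) (f g : T.domain) (hf : E δ (f : H) = f)
    (hg : E δ (g : H) = 0) (hif : Integrable φ (E.scalarMeasure (f : H)))
    (hig : Integrable φ (E.scalarMeasure (g : H))) : ⟪(f : H), T g⟫_ℂ = 0 := by
  have key (c : ℂ) (hc : ‖c‖ = 1) : c * ⟪(f : H), T g⟫_ℂ +
      starRingEnd ℂ c * ⟪(g : H), T f⟫_ℂ = 0 := by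
    have h1 := hT.2 (f + c • g)
    rw [Submodule.coe_add, Submodule.coe_smul, E.scalarMeasure_add hδ hf hg hc,
      integral_add_measure hif hig, ← hT.2 f, ← hT.2 g, LinearPMap.map_add, LinearPMap.map_smul,
      inner_add_left, inner_add_right, inner_add_right, inner_smul_left, inner_smul_left,
      inner_smul_right, inner_smul_right] at h1
    have h2 : starRingEnd ℂ c * c = 1 := by
      rw [mul_comm, Complex.mul_conj, Complex.normSq_eq_norm_sq, hc]; simp
    linear_combination h1 - ⟪(g : H), T g⟫_ℂ * h2
  have h1 := key 1 (by simp)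
  have h2 := key Complex.I (by simp)
  simp only [map_one, one_mul, Complex.conj_I] at h1 h2
  have h3 : Complex.I * (2 * ⟪(f : H), T g⟫_ℂ) = 0 := by linear_combination h2 + Complex.I * h1
  simpa using h3

variable {L : H →ₗ.[ℂ] H}

lemma IsGeneratedBy.integrable (hE : E.IsGeneratedBy L) (f : L.domain) :
    Integrable (fun z : ℂ => z) (E.scalarMeasure (f : H)) := by
  have h : MemLp (fun z : ℂ => z) 2 (E.scalarMeasure (f : H)) := by
    refine ⟨measurable_id.aestronglyMeasurable, ?_⟩
    rw [eLpNorm_lt_top_iff_lintegral_rpow_enorm_lt_top (by simp) (by simp)]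
    simpa using (hE.1 f).1 f.2
  exact h.integrable (by norm_num)

lemma IsGeneratedBy.apply_mem_domain (hE : E.IsGeneratedBy L) {δ : Set ℂ} (hδ : MeasurableSet δ)
    {f : H} (hf : f ∈ L.domain) : E δ f ∈ L.domain := by
  rw [hE.1, E.scalarMeasure_apply_eq_restrict hδ]
  exact (setLIntegral_le_lintegral _ _).trans_lt ((hE.1 f).1 hf)

lemma IsGeneratedBy.mem_domain_of_closedBall (hE : E.IsGeneratedBy L) {c : ℂ} {r : ℝ} {f : H}
    (hf : E (Metric.closedBall c r) f = f) : f ∈ L.domain := by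
  rw [hE.1]
  have hb := E.ae_mem Metric.isClosed_closedBall.measurableSet hf
  calc ∫⁻ z, ‖z‖ₑ ^ 2 ∂E.scalarMeasure f
      ≤ ∫⁻ _, ENNReal.ofReal (‖c‖ + r) ^ 2 ∂E.scalarMeasure f := by
        refine lintegral_mono_ae ?_
        filter_upwards [hb] with z hz
        gcongr
        rw [← ofReal_norm]
        refine ENNReal.ofReal_le_ofReal ?_
        have := norm_le_norm_add_norm_sub' z c
        rw [Metric.mem_closedBall, dist_eq_norm] at hz
        linarith
    _ < ∞ := by
        rw [lintegral_const]
        exact ENNReal.mul_lt_top (by simp) (measure_lt_top _ _)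

lemma IsGeneratedBy.commutesWith_self (hE : E.IsGeneratedBy L) (hd : Dense (L.domain : Set H))
    {δ : Set ℂ} (hδ : MeasurableSet δ) : L.CommutesWith (E δ) := by
  -- L maps the range of E(σ) into itself: L E(σ)f is orthogonal to E(σᶜ)h for h in the dense
  -- domain. Applied to δ and to δᶜ, this makes E(δ) reduce L.
  have key {σ : Set ℂ} (hσ : MeasurableSet σ) (f : L.domain) :
      E σᶜ (L ⟨E σ f, hE.apply_mem_domain hσ f.2⟩) = 0 := by
    refine hd.eq_zero_of_inner_right (𝕜 := ℂ) fun h hh => ?_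
    rw [← E.inner_apply_left hσ.compl]
    exact IsIntegral.inner_eq_zero hE hσ.compl ⟨E σᶜ h, hE.apply_mem_domain hσ.compl hh⟩ _
      (E.apply_apply_self hσ.compl _) (E.apply_disjoint hσ.compl hσ disjoint_compl_left _)
      (hE.integrable _) (hE.integrable _)
  intro x y hxy
  obtain ⟨f, rfl, rfl⟩ := (L.mem_graph_iff).1 hxy
  refine (L.mem_graph_iff).2 ⟨⟨E δ f, hE.apply_mem_domain hδ f.2⟩, rfl, ?_⟩
  have h1 : f = (⟨E δ f, hE.apply_mem_domain hδ f.2⟩ : L.domain) +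
      ⟨E δᶜ f, hE.apply_mem_domain hδ.compl f.2⟩ := by
    ext
    simp [E.apply_compl hδ]
  have h2 := key hδ f
  have h3 := key hδ.compl f
  rw [← E.apply_eq_self_iff_compl hδ] at h2
  simp only [compl_compl] at h3
  conv_rhs => rw [h1, LinearPMap.map_add]
  dsimp only
  rw [map_add, h2, h3, add_zero]

lemma IsGeneratedBy.norm_inner_sub_le (hE : E.IsGeneratedBy L) {c : ℂ} {r : ℝ} (f : L.domain)
    (hf : E (Metric.closedBall c r) (f : H) = f) :
    ‖⟪(f : H), L f - c • (f : H)⟫_ℂ‖ ≤ r * ‖(f : H)‖ ^ 2 := by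
  have hb := E.ae_mem Metric.isClosed_closedBall.measurableSet hf
  have h1 : ⟪(f : H), L f - c • (f : H)⟫_ℂ = ∫ z, (z - c) ∂E.scalarMeasure (f : H) := by
    rw [integral_sub (hE.integrable f) (integrable_const c), integral_const,
      E.scalarMeasure_real_univ, inner_sub_right, inner_smul_right, hE.2 f,
      inner_self_eq_norm_sq_to_K, Complex.real_smul, mul_comm c]
    simp
  rw [h1, ← E.scalarMeasure_real_univ (f : H)]
  refine norm_integral_le_of_norm_le_const ?_
  filter_upwards [hb] with z hz
  rwa [Metric.mem_closedBall, dist_eq_norm] at hz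

end Generated

/-! ### Norm bound by twice the numerical radius -/

section NumericalRadius

variable {H : Type*} [NormedAddCommGroup H] [InnerProductSpace ℂ H]

lemma norm_le_of_norm_inner_self_le (A : H →ₗ[ℂ] H) {r : ℝ}
    (hA : ∀ x, ‖⟪A x, x⟫_ℂ‖ ≤ r * ‖x‖ ^ 2) (y : H) : ‖A y‖ ≤ 2 * r * ‖y‖ := by
  have bound (x : H) : ‖⟪A y, x⟫_ℂ‖ ≤ r * (‖x‖ ^ 2 + ‖y‖ ^ 2) := by
    have p1 := parallelogram_law_with_norm ℂ x y
    have p2 := parallelogram_law_with_norm ℂ x (Complex.I • y)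
    rw [norm_smul, Complex.norm_I, one_mul] at p2
    rw [inner_map_polarization, norm_div]
    have h4 : ‖(4 : ℂ)‖ = 4 := by simp
    rw [h4, div_le_iff₀ (by norm_num)]
    have n1 := hA (x + y)
    have n2 := hA (x - y)
    have n3 := hA (x + Complex.I • y)
    have n4 := hA (x - Complex.I • y)
    refine (norm_sub_le _ _).trans ?_
    refine (add_le_add_left ((norm_add_le _ _).trans (add_le_add_left (norm_sub_le _ _) _)) _).trans
      ?_
    rw [norm_mul, norm_mul, Complex.norm_I, one_mul, one_mul]
    have e1 : r * (‖x + y‖ ^ 2 + ‖x - y‖ ^ 2) = r * (2 * (‖x‖ ^ 2 + ‖y‖ ^ 2)) := by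
      rw [p1]
    have e2 : r * (‖x + Complex.I • y‖ ^ 2 +
        ‖x - Complex.I • y‖ ^ 2) = r * (2 * (‖x‖ ^ 2 + ‖y‖ ^ 2)) := by
      rw [p2]
    linarith
  rcases eq_or_ne (A y) 0 with h0 | h0
  · have := (norm_nonneg _).trans (hA y)
    rcases eq_or_ne y 0 with rfl | hy
    · simp
    · have hy' : 0 < ‖y‖ := norm_pos_iff.2 hy
      have hr : 0 ≤ r := nonneg_of_mul_nonneg_left this (by positivity)
      rw [h0, norm_zero]
      positivity
  · have ha : 0 < ‖A y‖ := norm_pos_iff.2 h0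
    -- Al multiple of Ay rescaled to have norm ‖y‖.
    have h := bound (((‖y‖ / ‖A y‖ : ℝ) : ℂ) • A y)
    rw [inner_smul_right, inner_self_eq_norm_sq_to_K, norm_mul, norm_smul, Complex.norm_real,
      Real.norm_of_nonneg (by positivity), div_mul_cancel₀ _ ha.ne', norm_pow] at h
    rcases eq_or_ne y 0 with rfl | hy
    · simp at h0
    have hy' : 0 < ‖y‖ := norm_pos_iff.2 hy
    have h' : ‖y‖ * ‖A y‖ ≤ ‖y‖ * (2 * r * ‖y‖) := by
      calc ‖y‖ * ‖A y‖ = ‖y‖ / ‖A y‖ * ‖A y‖ ^ 2 := by field_simp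
        _ ≤ r * (‖y‖ ^ 2 + ‖y‖ ^ 2) := by simpa using h
        _ = _ := by ring
    exact le_of_mul_le_mul_left h' hy'

end NumericalRadius

/-! ### Fuglede's theorem -/

section Commutation

variable {H : Type*} [NormedAddCommGroup H] [InnerProductSpace ℂ H] [CompleteSpace H]
  {E : SpectralMeasure H} {L : H →ₗ.[ℂ] H}

lemma IsGeneratedBy.apply_eq_of_apply_eq_self (hE : E.IsGeneratedBy L)
    (hd : Dense (L.domain : Set H)) {δ : Set ℂ} (hδ : MeasurableSet δ) (f : L.domain)
    (hf : E δ (f : H) = f) : E δ (L f) = L f := by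
  have h := hE.commutesWith_self hd hδ _ _ (L.mem_graph f)
  rw [hf] at h
  exact L.mem_graph_snd_inj h (L.mem_graph f) rfl

/-- The compression of L - c to the disc is everywhere defined and has numerical radius at most r;
the 2 comes from polarization. -/
lemma IsGeneratedBy.norm_sub_smul_le (hE : E.IsGeneratedBy L) (hd : Dense (L.domain : Set H))
    {c : ℂ} {r : ℝ} (f : L.domain) (hf : E (Metric.closedBall c r) (f : H) = f) :
    ‖L f - c • (f : H)‖ ≤ 2 * r * ‖(f : H)‖ := by
  have hm : MeasurableSet (Metric.closedBall c r) := Metric.isClosed_closedBall.measurableSet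
  have hmem (x : H) : E (Metric.closedBall c r) x ∈ L.domain :=
    hE.mem_domain_of_closedBall (E.apply_apply_self hm x)
  let P : H →ₗ[ℂ] L.domain :=
    LinearMap.codRestrict L.domain (E (Metric.closedBall c r) : H →ₗ[ℂ] H) hmem
  let A : H →ₗ[ℂ] H := L.toFun ∘ₗ P - c • (L.domain.subtype ∘ₗ P)
  have hr : (f : H) ≠ 0 → 0 ≤ r := by
    intro h0
    by_contra hneg
    rw [Metric.closedBall_eq_empty.2 (not_le.1 hneg), E.map_empty_apply] at hf
    exact h0 hf.symm
  rcases eq_or_ne (f : H) 0 with h0 | h0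
  · have : f = 0 := by ext; exact h0
    subst this
    simp
  have hPf : P f = f := Subtype.ext hf
  have hA : ∀ x, ‖⟪A x, x⟫_ℂ‖ ≤ r * ‖x‖ ^ 2 := by
    intro x
    have h1 : E (Metric.closedBall c r) ((P x : L.domain) : H) = P x := E.apply_apply_self hm x
    have h2 : E (Metric.closedBall c r) (A x) = A x := by
      change E (Metric.closedBall c r) (L (P x) - c • ((P x : L.domain) : H)) =
        L (P x) - c • ((P x : L.domain) : H)
      rw [map_sub, map_smul, hE.apply_eq_of_apply_eq_self hd hm _ h1, h1]
    rw [← h2, E.inner_apply_left hm, ← inner_conj_symm, RCLike.norm_conj]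
    refine (hE.norm_inner_sub_le (P x) h1).trans ?_
    exact mul_le_mul_of_nonneg_left (pow_le_pow_left₀ (norm_nonneg _) (E.norm_apply_le hm x) 2)
      (hr h0)
  have := norm_le_of_norm_inner_self_le A hA f
  change ‖L (P f) - c • ((P f : L.domain) : H)‖ ≤ _ at this
  rwa [hPf] at this

/-- For X = PTQ, (b - c)X = X(L - c) - (L - b)X on the range of Q. Each term on the right costs
2r‖X‖, so ‖X‖ ≤ (4r / |b - c|)‖X‖ with a factor below 1. -/
lemma IsGeneratedBy.apply_comp_apply_eq_zero (hE : E.IsGeneratedBy L)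
    (hd : Dense (L.domain : Set H)) {T : H →L[ℂ] H} (hT : L.CommutesWith T) {b c : ℂ} {r : ℝ}
    (hr : 4 * r < ‖b - c‖) (x : H) :
    E (Metric.closedBall b r) (T (E (Metric.closedBall c r) x)) = 0 := by
  rcases lt_or_ge r 0 with hneg | hr0
  · rw [Metric.closedBall_eq_empty.2 hneg, E.map_empty_apply]
  have hb : MeasurableSet (Metric.closedBall b r) := Metric.isClosed_closedBall.measurableSet
  have hc : MeasurableSet (Metric.closedBall c r) := Metric.isClosed_closedBall.measurableSet
  set P := E (Metric.closedBall b r)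
  set Q := E (Metric.closedBall c r)
  let X : H →L[ℂ] H := P ∘L T ∘L Q
  have hpos : 0 < ‖b - c‖ := by linarith
  have bound (x : H) : ‖X x‖ ≤ 4 * r / ‖b - c‖ * ‖X‖ * ‖x‖ := by
    have hy : Q (Q x) = Q x := E.apply_apply_self hc x
    let y : L.domain := ⟨Q x, hE.mem_domain_of_closedBall hy⟩
    have hLy : Q (L y) = L y := hE.apply_eq_of_apply_eq_self hd hc y hy
    have hv := hE.commutesWith_self hd hb _ _ (hT _ _ (L.mem_graph y))
    obtain ⟨v, hv1, hv2⟩ := (L.mem_graph_iff).1 hv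
    have hv1' : (v : H) = X x := hv1
    have hvP : P (v : H) = v := by rw [hv1]; exact E.apply_apply_self hb _
    have hv2' : L v = X (L y) := by
      change L v = P (T (Q (L y)))
      rw [hLy]; exact hv2
    have hXy : X (y : H) = X x := by
      change P (T (Q (Q x))) = P (T (Q x))
      rw [hy]
    have n1 := hE.norm_sub_smul_le hd v hvP
    have n2 := hE.norm_sub_smul_le hd y hy
    have e : (b - c) • X x = X (L y - c • (y : H)) - (L v - b • (v : H)) := by
      rw [map_sub, map_smul, hXy, hv2', hv1', sub_smul]
      abel
    have n3 : ‖b - c‖ * ‖X x‖ ≤ ‖X‖ * (2 * r * ‖x‖) + 2 * r * (‖X‖ * ‖x‖) := by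
      rw [← norm_smul, e]
      refine (norm_sub_le _ _).trans (add_le_add ?_ ?_)
      · refine (X.le_opNorm _).trans (mul_le_mul_of_nonneg_left (n2.trans ?_) (norm_nonneg _))
        exact mul_le_mul_of_nonneg_left (E.norm_apply_le hc x) (by positivity)
      · refine n1.trans (mul_le_mul_of_nonneg_left ?_ (by positivity))
        rw [hv1']; exact X.le_opNorm x
    rw [div_mul_eq_mul_div, div_mul_eq_mul_div, le_div_iff₀ hpos]
    linarith
  have hle := X.opNorm_le_bound (by positivity) bound
  have hlt : 4 * r / ‖b - c‖ < 1 := (div_lt_one hpos).2 hr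
  have hX0 : ‖X‖ = 0 := by nlinarith [norm_nonneg X]
  have : X = 0 := norm_eq_zero.1 hX0
  exact congrArg (fun A : H →L[ℂ] H => A x) this

/-- A locally null set is null for the scalar measure of f, since ℂ is second countable. -/
lemma apply_eq_zero_of_forall_mem_closedBall (E : SpectralMeasure H) {δ : Set ℂ}
    (hδ : MeasurableSet δ) {f : H}
    (h : ∀ z ∈ δ, ∃ r : ℝ, 0 < r ∧ E (Metric.closedBall z r) f = 0) : E δ f = 0 := by
  rw [← E.scalarMeasure_eq_zero_iff hδ]
  refine measure_null_of_locally_null _ fun z hz => ?_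
  obtain ⟨r, hr, h0⟩ := h z hz
  exact ⟨_, mem_nhdsWithin_of_mem_nhds (Metric.closedBall_mem_nhds z hr),
    (E.scalarMeasure_eq_zero_iff Metric.isClosed_closedBall.measurableSet f).2 h0⟩

lemma star_swap_eq_zero (E : SpectralMeasure H) {T : H →L[ℂ] H} {δ δ' : Set ℂ}
    (hδ : MeasurableSet δ) (hδ' : MeasurableSet δ') (h : ∀ x, E δ (T (E δ' x)) = 0) (x : H) :
    E δ' (star T (E δ x)) = 0 := by
  refine ext_inner_left ℂ fun y => ?_
  rw [← E.inner_apply_left hδ', inner_zero_right, ContinuousLinearMap.star_eq_adjoint,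
    ContinuousLinearMap.adjoint_inner_right, ← E.inner_apply_left hδ, h, inner_zero_left]

/-- Covering by discs works only for the outer projection, applied last. For the other order, pass
to T*, cover there, and return by taking adjoints. -/
lemma IsGeneratedBy.apply_comp_far_eq_zero (hE : E.IsGeneratedBy L)
    (hd : Dense (L.domain : Set H)) {T : H →L[ℂ] H} (hT : L.CommutesWith T) (b : ℂ) {r : ℝ}
    (hr : 0 < r) (x : H) :
    E (Metric.closedBall b (4 * r))ᶜ (T (E (Metric.closedBall b r) x)) = 0 ∧
      E (Metric.closedBall b r) (T (E (Metric.closedBall b (4 * r))ᶜ x)) = 0 := by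
  have hm (s : ℝ) (z : ℂ) : MeasurableSet (Metric.closedBall z s) :=
    Metric.isClosed_closedBall.measurableSet
  have hfar {z : ℂ} (hz : z ∈ (Metric.closedBall b (4 * r))ᶜ) : 4 * r < ‖z - b‖ := by
    rw [Set.mem_compl_iff, Metric.mem_closedBall, dist_eq_norm, not_le] at hz
    exact hz
  refine ⟨E.apply_eq_zero_of_forall_mem_closedBall (hm _ _).compl fun z hz =>
    ⟨r, hr, hE.apply_comp_apply_eq_zero hd hT (hfar hz) x⟩, ?_⟩
  have h := E.star_swap_eq_zero (T := star T) (hm (4 * r) b).compl (hm r b) (fun y =>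
    E.apply_eq_zero_of_forall_mem_closedBall (hm _ _).compl fun z hz => ⟨r, hr,
      E.star_swap_eq_zero (hm _ _) (hm _ _) (hE.apply_comp_apply_eq_zero hd hT
        (by rw [norm_sub_rev]; exact hfar hz)) y⟩) x
  rwa [star_star] at h

/-- Fuglede's theorem: a bounded operator that commutes with a normal operator commutes with its
resolution of the identity. -/
theorem IsGeneratedBy.commute_apply (hE : E.IsGeneratedBy L) (hd : Dense (L.domain : Set H))
    {T : H →L[ℂ] H} (hT : L.CommutesWith T) {δ : Set ℂ} (hδ : MeasurableSet δ) (x : H) :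
    T (E δ x) = E δ (T x) := by
  have hm (s : ℝ) (z : ℂ) : MeasurableSet (Metric.closedBall z s) :=
    Metric.isClosed_closedBall.measurableSet
  induction δ, hδ using MeasurableSpace.induction_on_inter
    (BorelSpace.measurable_eq.trans rfl : _ = MeasurableSpace.generateFrom {s : Set ℂ | IsOpen s})
    isPiSystem_isOpen generalizing x with
  | empty => simp [E.map_empty_apply]
  | basic U hU =>
    have hUo : IsOpen U := hU
    have hUm : MeasurableSet U := hUo.measurableSet
    -- A quarter of the radius of a disc inside U, so that Uᶜ is far from the small disc in the
    -- sense of the 4r bound.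
    have hball (z : ℂ) (hz : z ∈ U) :
        ∃ r : ℝ, 0 < r ∧ Uᶜ ⊆ (Metric.closedBall z (4 * r))ᶜ := by
      obtain ⟨r, hr, h⟩ := Metric.nhds_basis_closedBall.mem_iff.1 (hUo.mem_nhds hz)
      exact ⟨r / 4, by positivity, Set.compl_subset_compl.2 (by rwa [mul_div_cancel₀ r four_ne_zero])⟩
    have hsub {σ τ : Set ℂ} (hσ : MeasurableSet σ) (hτ : MeasurableSet τ) (h : σ ⊆ τ) (y : H) :
        E τ (E σ y) = E σ y := by
      rw [E.apply_inter hτ hσ, Set.inter_eq_right.2 h]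
    have h1 (x : H) : E U (T (E Uᶜ x)) = 0 := by
      refine E.apply_eq_zero_of_forall_mem_closedBall hUm fun z hz => ?_
      obtain ⟨r, hr, h⟩ := hball z hz
      refine ⟨r, hr, ?_⟩
      rw [← hsub hUm.compl (hm _ _).compl h]
      exact (hE.apply_comp_far_eq_zero hd hT z hr _).2
    have h2 (x : H) : E Uᶜ (T (E U x)) = 0 := by
      have h := E.star_swap_eq_zero (T := star T) hUm hUm.compl (fun y =>
        E.apply_eq_zero_of_forall_mem_closedBall hUm fun z hz => by
          obtain ⟨r, hr, h⟩ := hball z hz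
          refine ⟨r, hr, E.star_swap_eq_zero hUm.compl (hm _ _) (fun w => ?_) y⟩
          rw [← hsub hUm.compl (hm _ _).compl h, E.apply_comm (hm _ _).compl hUm.compl,
            (hE.apply_comp_far_eq_zero hd hT z hr w).1, map_zero]) x
      rwa [star_star] at h
    have h3 := h1 x
    have h4 := h2 x
    rw [E.apply_compl hUm, map_sub, map_sub, sub_eq_zero] at h3
    rw [← E.apply_eq_self_iff_compl hUm] at h4
    rw [← h4, h3]
  | compl t ht ih => rw [E.apply_compl ht, E.apply_compl ht, map_sub, ih]
  | iUnion s hdisj hs ih =>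
    refine ((E.hasSum_iUnion' s hs hdisj x).mapL T).unique ?_
    simp_rw [ih]
    exact E.hasSum_iUnion' s hs hdisj (T x)

end Commutation

end SpectralMeasure

namespace SpectralMeasure

/-! ### Eigenvectors and functions of L -/

section Eigenvectors

variable {H : Type*} [NormedAddCommGroup H] [InnerProductSpace ℂ H] [CompleteSpace H]
  {E : SpectralMeasure H} {L : H →ₗ.[ℂ] H}

/-- Near z ≠ c, the projection v of f to the disc of radius |c - z|/2 is still in the c-eigenspace,
so |c - z| ‖v‖² ≤ (|c - z|/2) ‖v‖² and v = 0. -/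
lemma IsGeneratedBy.apply_singleton_of_eigenvector (hE : E.IsGeneratedBy L)
    (hd : Dense (L.domain : Set H)) {f : H} {c : ℂ} (hf : (f, c • f) ∈ L.graph) :
    E {c} f = f := by
  rw [E.apply_eq_self_iff_compl (MeasurableSet.singleton c)]
  refine E.apply_eq_zero_of_forall_mem_closedBall (MeasurableSet.singleton c).compl fun z hz => ?_
  have hpos : 0 < ‖c - z‖ := norm_pos_iff.2 (sub_ne_zero.2 fun h => hz h.symm)
  refine ⟨‖c - z‖ / 2, by positivity, ?_⟩
  have hm : MeasurableSet (Metric.closedBall z (‖c - z‖ / 2)) :=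
    Metric.isClosed_closedBall.measurableSet
  have h1 := hE.commutesWith_self hd hm _ _ hf
  obtain ⟨v, hv1, hv2⟩ := (L.mem_graph_iff).1 h1
  dsimp only at hv1 hv2
  rw [← hv1]
  have h2 := hE.norm_inner_sub_le v (by rw [hv1]; exact E.apply_apply_self hm f)
  rw [hv2, map_smul, ← hv1, ← sub_smul, inner_smul_right, norm_mul,
    inner_self_eq_norm_sq_to_K, norm_pow] at h2
  simp only [Complex.coe_algebraMap, Complex.norm_real, norm_norm] at h2
  have h3 : ‖(v : H)‖ ^ 2 ≤ 0 := by
    by_contra h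
    rw [not_le] at h
    nlinarith [mul_pos hpos h]
  simpa using le_antisymm h3 (by positivity)

lemma integral_eq_of_apply_singleton (φ : ℂ → ℂ) {f : H} {c : ℂ} (hf : E {c} f = f) :
    Integrable φ (E.scalarMeasure f) ∧
      ∫ z, φ z ∂E.scalarMeasure f = φ c * ⟪f, f⟫_ℂ := by
  have h : φ =ᵐ[E.scalarMeasure f] fun _ => φ c := by
    filter_upwards [E.ae_mem (MeasurableSet.singleton c) hf] with z hz
    rw [Set.mem_singleton_iff.1 hz]
  refine ⟨(integrable_congr h).2 (integrable_const _), ?_⟩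
  rw [integral_congr_ae h, integral_const, E.scalarMeasure_real_univ, inner_self_eq_norm_sq_to_K,
    Complex.real_smul, mul_comm]
  simp

/-- For a = b the compression of R - φ(a) to the range of E({a}) has zero quadratic form, hence
vanishes over ℂ. For a ≠ b both sides are zero by orthogonality. -/
lemma IsIntegral.inner_eq_mul_inner {φ : ℂ → ℂ} {R : H →L[ℂ] H}
    (hR : E.IsIntegral φ ((R : H →ₗ[ℂ] H).toPMap ⊤)) {f g : H} {a b : ℂ} (hf : E {a} f = f)
    (hg : E {b} g = g) : ⟪g, R f⟫_ℂ = φ a * ⟪g, f⟫_ℂ := by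
  have ma : MeasurableSet ({a} : Set ℂ) := MeasurableSet.singleton a
  have mb : MeasurableSet ({b} : Set ℂ) := MeasurableSet.singleton b
  by_cases hab : a = b
  · subst hab
    let A : H →ₗ[ℂ] H := ((E {a} ∘L (R - φ a • ContinuousLinearMap.id ℂ H) ∘L E {a} :
      H →L[ℂ] H) : H →ₗ[ℂ] H)
    have hA : A = 0 := by
      rw [← inner_map_self_eq_zero]
      intro x
      change ⟪E {a} (R (E {a} x) - φ a • E {a} x), x⟫_ℂ = 0
      have hx := E.apply_apply_self ma x
      have h1 := hR.2 ⟨E {a} x, trivial⟩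
      change ⟪E {a} x, R (E {a} x)⟫_ℂ = ∫ z, φ z ∂E.scalarMeasure (E {a} x) at h1
      rw [(integral_eq_of_apply_singleton φ hx).2] at h1
      rw [E.inner_apply_left ma, ← inner_conj_symm, inner_sub_right, inner_smul_right,
        h1, sub_self, map_zero]
    have h2 : E {a} (R (E {a} f) - φ a • E {a} f) = 0 := congrArg (fun B : H →ₗ[ℂ] H => B f) hA
    rw [hf] at h2
    have h3 : ⟪g, R f - φ a • f⟫_ℂ = 0 := by
      rw [← hg, E.inner_apply_left ma, h2, inner_zero_right]
    rwa [inner_sub_right, inner_smul_right, sub_eq_zero] at h3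
  · have hz : E {b} f = 0 := by
      rw [← hf]
      exact E.apply_disjoint mb ma (Set.disjoint_singleton.2 (Ne.symm hab)) f
    have h1 : ⟪g, f⟫_ℂ = 0 := by rw [← hg, E.inner_apply_left mb, hz, inner_zero_right]
    rw [h1, mul_zero]
    exact hR.inner_eq_zero mb ⟨g, trivial⟩ ⟨f, trivial⟩ hg hz
      (integral_eq_of_apply_singleton φ hg).1 (integral_eq_of_apply_singleton φ hf).1

end Eigenvectors

end SpectralMeasure

/-! ### Diagonal operators and partial sums in the eigenbasis -/

section PointSpectrum

variable {H : Type*} [NormedAddCommGroup H] [InnerProductSpace ℂ H]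

lemma LinearPMap.mem_spec_of_eigenvector {L : H →ₗ.[ℂ] H} {f : H} {c : ℂ} (h0 : f ≠ 0)
    (hf : (f, c • f) ∈ L.graph) : c ∈ L.spec := by
  rintro ⟨B, hB, -⟩
  obtain ⟨v, hv1, hv2⟩ := (L.mem_graph_iff).1 hf
  dsimp only at hv1 hv2
  have h := hB v
  rw [hv2, ← hv1, sub_self, _root_.map_zero] at h
  exact h0 (hv1.symm.trans h.symm)

lemma HilbertBasis.ext_inner (e : HilbertBasis ℕ ℂ H) {x y : H}
    (h : ∀ j, ⟪e j, x⟫_ℂ = ⟪e j, y⟫_ℂ) : x = y := by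
  apply e.repr.injective
  ext j
  simpa only [e.repr_apply_apply] using h j

lemma HilbertBasis.hasSum_inner_smul (e : HilbertBasis ℕ ℂ H) (x : H) :
    HasSum (fun j => ⟪e j, x⟫_ℂ • e j) x := by
  simpa only [e.repr_apply_apply] using e.hasSum_repr x

lemma HilbertBasis.inner_apply_of_diagonal (e : HilbertBasis ℕ ℂ H) {R : H →L[ℂ] H} {ρ : ℕ → ℂ}
    (hR : ∀ j, R (e j) = ρ j • e j) (j : ℕ) (x : H) : ⟪e j, R x⟫_ℂ = ρ j * ⟪e j, x⟫_ℂ := by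
  have h := (e.hasSum_inner_smul x).mapL (innerSL ℂ (e j) ∘L R)
  refine h.unique ?_
  convert hasSum_single j fun i hi => ?_ using 1
  · simp [hR, e.orthonormal.norm_eq_one, mul_comm]
  · simp [hR, orthonormal_iff_ite.1 e.orthonormal, hi.symm]

variable [CompleteSpace H]

lemma SpectralMeasure.IsFunctionOf.apply_eigenbasis {E : SpectralMeasure H} {L : H →ₗ.[ℂ] H}
    (hE : E.IsGeneratedBy L) (hd : Dense (L.domain : Set H)) (e : HilbertBasis ℕ ℂ H) {ev : ℕ → ℂ}
    (hev : ∀ j, (e j, ev j • e j) ∈ L.graph) {ω : L.spec → ℂ} {R : H →L[ℂ] H}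
    (hω : ∀ z, ω z ≠ 0) (hR : E.IsFunctionOf L ω R) :
    ∃ ρ : ℕ → ℂ, (∀ j, ρ j ≠ 0) ∧ ∀ j, R (e j) = ρ j • e j := by
  -- The extension by 0 off the spectrum is harmless: eigenvalues lie in the spectrum.
  refine ⟨fun j => Function.extend Subtype.val ω 0 (ev j), fun j => ?_, fun j => ?_⟩
  · have hs : ev j ∈ L.spec := LinearPMap.mem_spec_of_eigenvector (e.orthonormal.ne_zero j) (hev j)
    have := Subtype.val_injective.extend_apply ω 0 ⟨ev j, hs⟩
    dsimp only at this ⊢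
    rw [this]
    exact hω _
  · refine e.ext_inner fun k => ?_
    rw [inner_smul_right]
    exact SpectralMeasure.IsIntegral.inner_eq_mul_inner hR
      (hE.apply_singleton_of_eigenvector hd (hev j)) (hE.apply_singleton_of_eigenvector hd (hev k))

lemma basisProj_apply (e : HilbertBasis ℕ ℂ H) (k : ℕ) (x : H) :
    basisProj e k x = ∑ j ∈ Finset.range k, ⟪e j, x⟫_ℂ • e j := by
  unfold basisProj
  have : FiniteDimensional ℂ (Submodule.span ℂ (Set.range fun j : Fin k => e j)) :=
    FiniteDimensional.span_of_finite ℂ (Set.finite_range _)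
  refine Submodule.eq_starProjection_of_mem_of_inner_eq_zero ?_ fun w hw => ?_
  · refine Submodule.sum_mem _ fun j hj => Submodule.smul_mem _ _ (Submodule.subset_span ?_)
    exact ⟨⟨j, Finset.mem_range.1 hj⟩, rfl⟩
  · induction hw using Submodule.span_induction with
    | mem y hy =>
      obtain ⟨i, rfl⟩ := hy
      rw [← inner_conj_symm, inner_sub_right, inner_sum]
      simp [inner_smul_right, orthonormal_iff_ite.1 e.orthonormal]
    | zero => simp
    | add y z _ _ hy hz => rw [inner_add_right, hy, hz, add_zero]
    | smul a y _ hy => rw [inner_smul_right, hy, mul_zero]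

lemma basisProj_basisProj (e : HilbertBasis ℕ ℂ H) {k l : ℕ} (h : k ≤ l) (x : H) :
    basisProj e l (basisProj e k x) = basisProj e k x := by
  rw [basisProj_apply e l, basisProj_apply e k]
  rw [← Finset.sum_subset (Finset.range_mono h) (f := fun j =>
    ⟪e j, ∑ i ∈ Finset.range k, ⟪e i, x⟫_ℂ • e i⟫_ℂ • e j)]
  · refine Finset.sum_congr rfl fun j hj => ?_
    rw [inner_sum]
    simp only [inner_smul_right, orthonormal_iff_ite.1 e.orthonormal, mul_ite, mul_one, mul_zero,
      Finset.sum_ite_eq, hj, if_true]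
  · intro j _ hj
    rw [inner_sum]
    simp only [inner_smul_right, orthonormal_iff_ite.1 e.orthonormal, mul_ite, mul_one, mul_zero,
      Finset.sum_ite_eq, hj, if_false, zero_smul]

lemma norm_sub_basisProj_le (e : HilbertBasis ℕ ℂ H) (k : ℕ) (x : H) :
    ‖x - basisProj e k x‖ ≤ ‖x‖ := by
  have : FiniteDimensional ℂ (Submodule.span ℂ (Set.range fun j : Fin k => e j)) :=
    FiniteDimensional.span_of_finite ℂ (Set.finite_range _)
  have h := Submodule.starProjection_minimal
    (U := Submodule.span ℂ (Set.range fun j : Fin k => e j)) x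
  change ‖x - basisProj e k x‖ = _ at h
  rw [h]
  refine (ciInf_le ⟨0, ?_⟩ (0 : Submodule.span ℂ (Set.range fun j : Fin k => e j))).trans ?_
  · rintro _ ⟨y, rfl⟩
    exact norm_nonneg _
  · simp

lemma antitone_norm_sub_basisProj (e : HilbertBasis ℕ ℂ H) (x : H) :
    Antitone fun k => ‖x - basisProj e k x‖ := by
  intro k l h
  have := norm_sub_basisProj_le e l (x - basisProj e k x)
  rwa [map_sub, basisProj_basisProj e h, sub_sub_sub_cancel_right] at this

lemma tendsto_norm_sub_basisProj (e : HilbertBasis ℕ ℂ H) (x : H) :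
    Tendsto (fun k => ‖x - basisProj e k x‖) atTop (𝓝 0) := by
  have h := ((e.hasSum_inner_smul x).tendsto_sum_nat.const_sub x).norm
  simpa only [sub_self, norm_zero, basisProj_apply] using h

lemma HilbertBasis.apply_basisProj_of_diagonal (e : HilbertBasis ℕ ℂ H) {R : H →L[ℂ] H}
    {ρ : ℕ → ℂ} (hR : ∀ j, R (e j) = ρ j • e j) (k : ℕ) (x : H) :
    R (basisProj e k x) = basisProj e k (R x) := by
  rw [basisProj_apply, basisProj_apply, map_sum]
  refine Finset.sum_congr rfl fun j _ => ?_
  rw [map_smul, hR, e.inner_apply_of_diagonal hR, smul_smul, mul_comm]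

end PointSpectrum

lemma norm_div_norm_mem_Icc {G : Type*} [SeminormedAddGroup G] {g y : G} (h : ‖y‖ ≤ ‖g‖) :
    ‖y‖ / ‖g‖ ∈ Set.Icc (0 : ℝ) 1 :=
  ⟨by positivity, div_le_one_of_le₀ h (norm_nonneg _)⟩

/-! ### Estimates and convergence in N -/

section Estimates

variable {H N V : Type*} [NormedAddCommGroup H] [InnerProductSpace ℂ H]
  [NormedAddCommGroup N] [NormedSpace ℂ N] [AddCommGroup V] [Module ℂ V]

lemma IsBoundedInto.inSpaceWith_norm_le {ιH : H →ₗ[ℂ] V} {ιN : N →ₗ[ℂ] V} {R S : H →L[ℂ] H}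
    {RN : H →L[ℂ] N} (hRN : IsBoundedInto ιH ιN R RN) {P : H →L[ℂ] H}
    (hP : ∀ x, P (P x) = P x) (hR : ∀ x, R (P x) = P (R x)) (hS : ∀ x, S (P x) = P (S x))
    {g : H} (hg : ‖g - P g‖ ≤ ‖g‖) :
    InSpaceWith ιH ιN (R (S g) - P (R (S g))) fun u =>
      ‖u‖ ≤ ‖RN‖ * ‖g‖ * ‖S ∘L (1 - P)‖ * (‖g - P g‖ / ‖g‖) := by
  refine ⟨RN (S (g - P g)), ?_, ?_⟩
  · rw [hRN, map_sub S, map_sub R, hS, hR]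
  · have h1 : S (g - P g) = (S ∘L (1 - P)) (g - P g) := by
      simp [hP]
    -- For g = 0 the quotient is 0/0 = 0, and the identity still holds.
    have h2 : ‖g - P g‖ = ‖g‖ * (‖g - P g‖ / ‖g‖) := by
      rcases eq_or_ne ‖g‖ 0 with h0 | h0
      · rw [h0] at hg ⊢
        rw [zero_mul]
        exact le_antisymm hg (norm_nonneg _)
      · field_simp
    calc ‖RN (S (g - P g))‖ ≤ ‖RN‖ * (‖S ∘L (1 - P)‖ * ‖g - P g‖) := by
          refine (RN.le_opNorm _).trans (mul_le_mul_of_nonneg_left ?_ (norm_nonneg _))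
          conv_lhs => rw [h1]
          exact ContinuousLinearMap.le_opNorm _ _
      _ = ‖RN‖ * ‖S ∘L (1 - P)‖ * ‖g - P g‖ := by ring
      _ = ‖RN‖ * ‖S ∘L (1 - P)‖ * (‖g‖ * (‖g - P g‖ / ‖g‖)) := by rw [← h2]
      _ = _ := by ring

/-- The series is the image under RS : H → N of the expansion of g, and continuous linear maps
preserve unconditional summability. -/
lemma IsBoundedInto.seriesConvergesUncond {ιH : H →ₗ[ℂ] V} {ιN : N →ₗ[ℂ] V} {R S : H →L[ℂ] H}
    {RN : H →L[ℂ] N} (hRN : IsBoundedInto ιH ιN R RN) (e : HilbertBasis ℕ ℂ H) {ρ σ : ℕ → ℂ}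
    (hR : ∀ j, R (e j) = ρ j • e j) (hS : ∀ j, S (e j) = σ j • e j) (g : H) :
    SeriesConvergesUncond ιH ιN (fun j => ⟪e j, R (S g)⟫_ℂ • e j) (R (S g)) := by
  have hsum := (e.hasSum_inner_smul g).mapL (RN ∘L S)
  refine ⟨fun j => (RN ∘L S) (⟪e j, g⟫_ℂ • e j), fun j => ?_, RN (S g), hRN _, fun τ => ?_⟩
  · change ιN (RN (S _)) = _
    dsimp only
    rw [hRN, map_smul S, hS, map_smul R, map_smul R, hR, e.inner_apply_of_diagonal hR,
      e.inner_apply_of_diagonal hS, smul_smul, smul_smul]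
    congr 2
    ring
  · exact ((Equiv.hasSum_iff τ).2 hsum).tendsto_sum_nat

variable [CompleteSpace H]

lemma IsBoundedInto.convergesUncond {ιH : H →ₗ[ℂ] V} {ιN : N →ₗ[ℂ] V} {R S : H →L[ℂ] H}
    {RN : H →L[ℂ] N} (hRN : IsBoundedInto ιH ιN R RN) (E : SpectralMeasure H)
    (hR : ∀ δ, MeasurableSet δ → ∀ x, R (E δ x) = E δ (R x))
    (hS : ∀ δ, MeasurableSet δ → ∀ x, S (E δ x) = E δ (S x)) (g : H) :
    ConvergesUncond ιH ιN E (R (S g)) := by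
  refine ⟨fun δ hδ => ⟨RN (S (E δ g)), by rw [hRN, hS δ hδ, hR δ hδ], trivial⟩, fun ε hε => ?_⟩
  set C := ‖RN ∘L S‖
  have ht := (E.tendsto_norm_sub_closedBall g).const_mul C
  rw [mul_zero] at ht
  obtain ⟨t, ht⟩ := (ht.eventually (gt_mem_nhds hε)).exists
  have hm : MeasurableSet (Metric.closedBall (0 : ℂ) t) := Metric.isClosed_closedBall.measurableSet
  refine ⟨_, hm, Metric.isBounded_closedBall, fun δ hδ hsub => ⟨RN (S (g - E δ g)), ?_, ?_⟩⟩
  · rw [hRN, map_sub S, map_sub R, hS δ hδ, hR δ hδ]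
  · refine (ContinuousLinearMap.le_opNorm (RN ∘L S) _).trans_lt (lt_of_le_of_lt ?_ ht)
    refine mul_le_mul_of_nonneg_left ?_ (norm_nonneg _)
    rw [← E.apply_compl hδ, ← E.apply_compl hm]
    exact E.norm_apply_mono hδ.compl hm.compl (Set.compl_subset_compl.2 hsub) g

end Estimates

/-! ### Assembly of (A) and (B) -/

theorem mainTheorem10
    {H N V : Type*}
    [NormedAddCommGroup H] [InnerProductSpace ℂ H] [CompleteSpace H]
    [NormedAddCommGroup N] [NormedSpace ℂ N]
    [AddCommGroup V] [Module ℂ V]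
    (ιH : H →ₗ[ℂ] V) (hιH : Function.Injective ιH)
    (ιN : N →ₗ[ℂ] V) (hιN : Function.Injective ιN)
    (L : H →ₗ.[ℂ] H) (hL : L.IsNormalOperator)
    (E : SpectralMeasure H) (hE : E.IsGeneratedBy L) :
    -- (A) general normal operators
    ((∀ (R S : H →L[ℂ] H) (RN : H →L[ℂ] N), L.CommutesWith R → L.CommutesWith S →
        IsBoundedInto ιH ιN R RN →
        ∀ f ∈ Set.range (R ∘L S), ConvergesUncond ιH ιN E f) ∧
      ∀ g : H, ∃ r : Set ℂ → ℝ,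
        (∀ δ, MeasurableSet δ → r δ ∈ Set.Icc (0 : ℝ) 1) ∧
        (∀ δ δ', MeasurableSet δ → MeasurableSet δ' → δ ⊆ δ' → r δ' ≤ r δ) ∧
        Tendsto (fun t : ℝ => r (Metric.closedBall (0 : ℂ) t)) atTop (𝓝 0) ∧
        ∀ (R S : H →L[ℂ] H) (RN : H →L[ℂ] N), L.CommutesWith R → L.CommutesWith S →
          IsBoundedInto ιH ιN R RN →
          ∀ f : H, f = R (S g) → ∀ δ : Set ℂ, MeasurableSet δ →
            InSpaceWith ιH ιN (f - E δ f)
              fun u => ‖u‖ ≤ ‖RN‖ * ‖g‖ * ‖S ∘L (1 - E δ)‖ * r δ) ∧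
    -- (B) normal operators with pure point spectrum
    (∀ (e : HilbertBasis ℕ ℂ H) (ev : ℕ → ℂ), (∀ j, (e j, ev j • e j) ∈ L.graph) →
      (∀ (ω η : L.spec → ℂ) (R S : H →L[ℂ] H) (RN : H →L[ℂ] N),
        Measurable ω → Measurable η →
        (∃ C : ℝ, ∀ z, ‖ω z‖ ≤ C) → (∃ C : ℝ, ∀ z, ‖η z‖ ≤ C) →
        (∀ z, ω z ≠ 0) → (∀ z, η z ≠ 0) →
        E.IsFunctionOf L ω R → E.IsFunctionOf L η S → IsBoundedInto ιH ιN R RN →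
        Function.Injective (R ∘L S) ∧
        ∀ f ∈ Set.range (R ∘L S),
          SeriesConvergesUncond ιH ιN (fun j => ⟪e j, f⟫_ℂ • e j) f) ∧
      ∀ g : H, ∃ r : ℕ → ℝ,
        (∀ k, r k ∈ Set.Icc (0 : ℝ) 1) ∧ Antitone r ∧ Tendsto r atTop (𝓝 0) ∧
        ∀ (ω η : L.spec → ℂ) (R S : H →L[ℂ] H) (RN : H →L[ℂ] N),
          Measurable ω → Measurable η →
          (∃ C : ℝ, ∀ z, ‖ω z‖ ≤ C) → (∃ C : ℝ, ∀ z, ‖η z‖ ≤ C) →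
          (∀ z, ω z ≠ 0) → (∀ z, η z ≠ 0) →
          E.IsFunctionOf L ω R → E.IsFunctionOf L η S → IsBoundedInto ιH ιN R RN →
          ∀ f : H, f = R (S g) → ∀ k : ℕ, 1 ≤ k →
            InSpaceWith ιH ιN (f - ∑ j ∈ Finset.range k, ⟪e j, f⟫_ℂ • e j)
              fun u => ‖u‖ ≤ ‖RN‖ * ‖g‖ * ‖S ∘L (1 - basisProj e k)‖ * r k) := by
  have hd := hL.1
  have hcomm {T : H →L[ℂ] H} (hT : L.CommutesWith T) (δ : Set ℂ) (hδ : MeasurableSet δ) (x : H) :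
      T (E δ x) = E δ (T x) := hE.commute_apply hd hT hδ x
  refine ⟨⟨?_, fun g => ?_⟩, fun e ev hev => ⟨?_, fun g => ?_⟩⟩
  · rintro R S RN hR hS hRN _ ⟨g, rfl⟩
    exact hRN.convergesUncond E (hcomm hR) (hcomm hS) g
  · have hle {δ : Set ℂ} (hδ : MeasurableSet δ) : ‖g - E δ g‖ ≤ ‖g‖ := by
      rw [← E.apply_compl hδ]
      exact E.norm_apply_le hδ.compl g
    refine ⟨fun δ => ‖g - E δ g‖ / ‖g‖, fun δ hδ => norm_div_norm_mem_Icc (hle hδ),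
      fun δ δ' hδ hδ' h => ?_, ?_, ?_⟩
    · refine div_le_div_of_nonneg_right ?_ (norm_nonneg _)
      rw [← E.apply_compl hδ, ← E.apply_compl hδ']
      exact E.norm_apply_mono hδ'.compl hδ.compl (Set.compl_subset_compl.2 h) g
    · simpa using (E.tendsto_norm_sub_closedBall g).div_const ‖g‖
    · rintro R S RN hR hS hRN _ rfl δ hδ
      exact hRN.inSpaceWith_norm_le (E.apply_apply_self hδ) (hcomm hR δ hδ) (hcomm hS δ hδ) (hle hδ)
  · intro ω η R S RN _ _ _ _ hω hη hR hS hRN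
    obtain ⟨ρ, hρ0, hρ⟩ := hR.apply_eigenbasis hE hd e hev hω
    obtain ⟨σ, hσ0, hσ⟩ := hS.apply_eigenbasis hE hd e hev hη
    refine ⟨(injective_iff_map_eq_zero _).2 fun x hx => e.ext_inner fun j => ?_, ?_⟩
    · have h : ⟪e j, R (S x)⟫_ℂ = 0 := by
        rw [show R (S x) = 0 from hx, inner_zero_right]
      rw [e.inner_apply_of_diagonal hρ, e.inner_apply_of_diagonal hσ] at h
      simpa [hρ0 j, hσ0 j] using h
    · rintro _ ⟨g, rfl⟩
      exact hRN.seriesConvergesUncond e hρ hσ g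
  · refine ⟨fun k => ‖g - basisProj e k g‖ / ‖g‖,
      fun k => norm_div_norm_mem_Icc (norm_sub_basisProj_le e k g),
      fun k l h => div_le_div_of_nonneg_right (antitone_norm_sub_basisProj e g h) (norm_nonneg _),
      by simpa using (tendsto_norm_sub_basisProj e g).div_const ‖g‖, ?_⟩
    rintro ω η R S RN _ _ _ _ hω hη hR hS hRN _ rfl k _
    obtain ⟨ρ, -, hρ⟩ := hR.apply_eigenbasis hE hd e hev hω
    obtain ⟨σ, -, hσ⟩ := hS.apply_eigenbasis hE hd e hev hη
    rw [← basisProj_apply]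
    exact hRN.inSpaceWith_norm_le (basisProj_basisProj e le_rfl)
      (e.apply_basisProj_of_diagonal hρ k) (e.apply_basisProj_of_diagonal hσ k)
      (norm_sub_basisProj_le e k g)
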